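/- For a real binary quadratic form $f(x,y)=ax^2+bxy+cy^2$ with $\Delta(f)=b^2-4ac>0$ let $C(f)=\inf_{(x,y)\in\mathbb Z^2\setminus\{(0,0)\}}|f(x,y)|/\sqrt{\Delta(f)}$ be its Markoff constant, and let $\mathrm{Mark}\subset\mathbb R$ be the set of all $C(f)$ with $a,b,c\in\mathbb Z$ and $\Delta(f)>0$ (the quadratic Markoff spectrum). For $u\in\mathbb Z$ let $M^{++}(2,0,u)$ be the equation $x^2+y^2+z^2=3xyz-ux$. For a solution $(m,m_1,m_2)$ of it in positive integers and integers $K,l$ with $Km_1\equiv m_2 \pmod m$ and $lm-K^2=1$, call $mx^2+(3m-2K)xy-(3K-l)y^2$ (of discriminant $9m^2-4$) a Markoff form attached to $(m,m_1,m_2)$. Then: 1. $1/3$ is the largest accumulation point of $\mathrm{Mark}$. It is an accumulation point both of $\mathrm{Mark}\cap(1/3,\infty)$ and of $\mathrm{Mark}\cap(-\infty,1/3)$. 2. From above: $1/3$ is an accumulation point of the set of those $C\in\mathrm{Mark}$, $C>1/3$, that are classical Markoff constants, i.e. $C=C(F)=m/\sqrt{9m^2-4}$ for a Markoff form $F$ attached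 to a positive solution $(m,m_1,m_2)$ of the Markoff equation $M^{++}(2,0,0)$. 3. From below: let $F_n$ be the Fibonacci numbers ($F_0=0$, $F_1=1$) and $p_k=F_{2k+2}$. For every $k\ge 1$ the triple $(p_k^2+p_{k-1}^2,\,p_k,\,p_{k-1})$ is a solution of $M^{++}(2,0,-2)$ in positive integers, and it has an attached Markoff form $F$ with $$C(F)=\frac{3p_kp_{k-1}-1}{\sqrt{9(p_k^2+p_{k-1}^2)^2-4}}\in\mathrm{Mark},\qquad C(F)<\frac13 .$$ These constants converge to $1/3$ as $k\to\infty$. -/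

import Mathlib

open Filter Topology

noncomputable section

/-- The Markoff constant `C(f) = m(f) / √Δ(f)` of the real binary quadratic form
`f(x,y) = a x² + b x y + c y²`, where `m(f)` is the infimum of `|f(x,y)|` over the nonzero
integer vectors and `Δ(f) = b² - 4ac`. It is used only when `Δ(f) > 0` (indefinite forms). -/
def markoffConstant (a b c : ℝ) : ℝ :=
  sInf {t : ℝ | ∃ x y : ℤ, (x, y) ≠ (0, 0) ∧ t = |a * x ^ 2 + b * x * y + c * y ^ 2|} /
    √(b ^ 2 - 4 * a * c)

/-- The quadratic Markoff spectrum: the Markoff constants of the indefinite binary quadratic forms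
with integer coefficients. -/
def quadraticMarkoffSpectrum : Set ℝ :=
  {C : ℝ | ∃ a b c : ℤ, 0 < b ^ 2 - 4 * a * c ∧ C = markoffConstant a b c}

/-- The Diophantine equation `M⁺⁺(2,0,u)`; for `u = 0` it is the classical Markoff equation. -/
def MarkoffEquation (u x y z : ℤ) : Prop :=
  x ^ 2 + y ^ 2 + z ^ 2 = 3 * x * y * z - u * x

/-- `(m, m₁, m₂)` is a positive solution of `M⁺⁺(2,0,u)`, and `K`, `l` are parameters
of the Markoff form that goes with it: `K m₁ ≡ m₂ (mod m)` and `l m - K² = 1`. -/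
structure IsMarkoffData (u m m₁ m₂ K l : ℤ) : Prop where
  pos : 0 < m
  pos₁ : 0 < m₁
  pos₂ : 0 < m₂
  equation : MarkoffEquation u m m₁ m₂
  congruence : K * m₁ ≡ m₂ [ZMOD m]
  det : l * m - K ^ 2 = 1

/-- The Markoff constant of the Markoff form
`m x² + (3m - 2K) x y - (3K - l) y²`, of discriminant `9m² - 4` when `l m - K² = 1`. -/
def markoffFormConstant (m K l : ℤ) : ℝ :=
  markoffConstant m (3 * m - 2 * K) (-(3 * K - l))

/-- The number `(3pq - 1) / √(9(p² + q²)² - 4)`. -/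
def lowerConstant (p q : ℕ) : ℝ :=
  (3 * (p : ℝ) * q - 1) / √(9 * ((p : ℝ) ^ 2 + (q : ℝ) ^ 2) ^ 2 - 4)

end

/-! Above 1/3 the spectrum is controlled by a weak form of Markoff's theorem. After a change of
basis and scaling, f(1,0) = 1 is the minimum of |f|, and C > 1/3 says that the roots θ < φ are less
than 3 apart. The Markoff fractions between two consecutive integers form a binary tree, and
`MarkoffArc.descent` follows the gap [φ, θ + 3] down it. Since |f| ≥ 1 at the left end of an arc
around the gap and at the right end shifted by -3, the gap is no longer than 1/max(m₁, m₂)²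
(`MarkoffArc.gap_mul_sq_le`). So the descent stops, at a fraction K/m lying in the gap, and
`markoff_isolation` gives discriminant 9 - 4/m². Hence C = m/√(9m² - 4), and only finitely many of
these values exceed a given r > 1/3.

The two sequences tending to 1/3 come from explicit minima: p for the classical form of (p, 1, q)
(`le_abs_classicalForm`), and m - 2 with m = P² + Q² for the lower family (`le_abs_lowerForm`). Both
are reductions of vectors, and in both the terminal case uses that the norm x² - 3xy + y² is a
nonzero integer. -/

/-! ### Isolation and descent in the Markoff tree -/

/-- If `K/m` and `K/m - 3` lie outside the root interval of a form normalised by `f(1,0) = 1`, and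
a Markoff neighbour `K₁/m₁` lies inside, then the form is determined by `K/m`. -/
theorem markoff_isolation {β γ m K m₁ K₁ m₂ : ℝ} (hm : 0 < m) (hm₁ : 0 < m₁) (hm₂ : 0 < m₂)
    (hdet : K * m₁ - K₁ * m = m₂) (heq : m ^ 2 + m₁ ^ 2 + m₂ ^ 2 = 3 * m * m₁ * m₂)
    (h0 : 1 ≤ K ^ 2 + β * K * m + γ * m ^ 2)
    (h3 : 1 ≤ (K - 3 * m) ^ 2 + β * (K - 3 * m) * m + γ * m ^ 2)
    (h1 : K₁ ^ 2 + β * K₁ * m₁ + γ * m₁ ^ 2 ≤ -1) :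
    m ^ 2 * (β ^ 2 - 4 * γ) = 9 * m ^ 2 - 4 := by
  have hlt : 0 < 3 * m * m₁ - m₂ := by
    have : 0 < m₂ * (3 * m * m₁ - m₂) := by nlinarith [sq_pos_of_pos hm, sq_pos_of_pos hm₁]
    exact pos_of_mul_pos_right this hm₂.le
  -- Interpolation of the monic quadratic f(t, 1) at K/m - 3 and K/m, evaluated at K₁/m₁. The left
  -- side is nonnegative and the right side nonpositive, so f equals 1 at both outer points.
  have key : m₁ * (m₂ * ((K - 3 * m) ^ 2 + β * (K - 3 * m) * m + γ * m ^ 2 - 1) +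
      (3 * m * m₁ - m₂) * (K ^ 2 + β * K * m + γ * m ^ 2 - 1)) =
      3 * m ^ 3 * (K₁ ^ 2 + β * K₁ * m₁ + γ * m₁ ^ 2 + 1) := by
    have hK : K₁ * m = K * m₁ - m₂ := by linarith
    have e1 : m ^ 3 * (K₁ ^ 2 + β * K₁ * m₁ + γ * m₁ ^ 2 + 1) =
        m * ((K₁ * m) ^ 2 + β * (K₁ * m) * m₁ * m + γ * m₁ ^ 2 * m ^ 2 + m ^ 2) := by ring
    rw [mul_assoc 3 (m ^ 3), e1, hK]
    linear_combination (-3 * m) * heq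
  have hR := mul_nonneg hm₂.le (sub_nonneg.2 h3)
  have hP := mul_nonneg hlt.le (sub_nonneg.2 h0)
  have hle : 3 * m ^ 3 * (K₁ ^ 2 + β * K₁ * m₁ + γ * m₁ ^ 2 + 1) ≤ 0 :=
    mul_nonpos_of_nonneg_of_nonpos (by positivity) (by linarith)
  rw [← key] at hle
  have hsum := nonpos_of_mul_nonpos_right hle hm₁
  have hR0 : (K - 3 * m) ^ 2 + β * (K - 3 * m) * m + γ * m ^ 2 - 1 = 0 :=
    (mul_eq_zero.1 (le_antisymm (by linarith) hR)).resolve_left hm₂.ne'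
  have hP0 : K ^ 2 + β * K * m + γ * m ^ 2 - 1 = 0 :=
    (mul_eq_zero.1 (le_antisymm (by linarith) hP)).resolve_left hlt.ne'
  have hβ : β * m = 3 * m - 2 * K := by
    have : (3 * m) * (β * m - (3 * m - 2 * K)) = 0 := by linear_combination hP0 - hR0
    rcases mul_eq_zero.1 this with h | h <;> linarith
  linear_combination (β * m + (3 * m - 2 * K) + 4 * K) * hβ - 4 * hP0

/-- B is at least (ℓ - x)(3 - ℓ - x) + xδ; the factor 3 - ℓ - x is at least 1 because x < ℓ ≤ 1, and
ℓ - x > δ. -/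
theorem gap_le {x δ ℓ A B : ℝ} (hx : 0 < x) (hδ : 0 < δ) (hℓ : x + δ < ℓ) (hℓ1 : ℓ ≤ 1)
    (hA : A ≤ x * (3 - x - δ)) (h : ℓ * (3 - ℓ) = A + B) : δ ≤ B := by
  nlinarith [mul_nonneg (by linarith : 0 ≤ ℓ - x) (by linarith : 0 ≤ 2 - ℓ - x), mul_pos hx hδ]

/-- The data of two consecutive Markoff fractions `K₁/m₁ < K₂/m₂`, together with the third member
`m₃` of their Markoff triple. -/
structure MarkoffArc (m₁ m₂ m₃ K₁ K₂ K₃ : ℤ) : Prop where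
  pos₁ : 0 < m₁
  pos₂ : 0 < m₂
  pos₃ : 0 < m₃
  equation : m₁ ^ 2 + m₂ ^ 2 + m₃ ^ 2 = 3 * m₁ * m₂ * m₃
  le_max : m₃ ≤ max m₁ m₂
  det₁₂ : K₂ * m₁ - K₁ * m₂ = m₃
  det₂₃ : K₃ * m₂ - K₂ * m₃ = m₁
  det₃₁ : (K₁ + 3 * m₁) * m₃ - K₃ * m₁ = m₂

namespace MarkoffArc

variable {m₁ m₂ m₃ K₁ K₂ K₃ : ℤ}

theorem base (n : ℤ) : MarkoffArc 1 1 1 n (n + 1) (n + 2) := by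
  constructor <;> norm_num

/-- Each subdivision inserts a denominator at least twice the current maximum, which makes the
descent progress. -/
theorem two_mul_max_le (h : MarkoffArc m₁ m₂ m₃ K₁ K₂ K₃) :
    2 * max m₁ m₂ ≤ 3 * m₁ * m₂ - m₃ := by
  have h1 := h.pos₁
  have h2 := h.pos₂
  have h3 := h.le_max
  rcases le_total m₁ m₂ with hm | hm
  · rw [max_eq_right hm] at *
    nlinarith
  · rw [max_eq_left hm] at *
    nlinarith

/-- Vieta's involution on m₃ gives the denominator of the inserted fraction. The numerator
transforms compatibly because K₁/m₁ < K₂/m₂ < K₃/m₃ < K₁/m₁ + 3 is cyclic modulo 3. -/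
theorem left (h : MarkoffArc m₁ m₂ m₃ K₁ K₂ K₃) :
    MarkoffArc m₁ (3 * m₁ * m₂ - m₃) m₂ K₁ (3 * m₁ * K₂ - K₃) K₂ := by
  have hmax := h.two_mul_max_le
  have h1 := h.pos₁
  have h2 := h.pos₂
  have := le_max_left m₁ m₂
  have := le_max_right m₁ m₂
  refine ⟨h1, by linarith, h2, ?_, le_max_of_le_right (by linarith), ?_, ?_, ?_⟩
  · linear_combination h.equation
  · linear_combination 3 * m₁ * h.det₁₂ + h.det₃₁
  · linear_combination h.det₂₃
  · linear_combination -h.det₁₂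

theorem right (h : MarkoffArc m₁ m₂ m₃ K₁ K₂ K₃) :
    MarkoffArc (3 * m₁ * m₂ - m₃) m₂ m₁ (3 * m₁ * K₂ - K₃) K₂ (K₁ + 3 * m₁) := by
  have hmax := h.two_mul_max_le
  have h1 := h.pos₁
  have h2 := h.pos₂
  have := le_max_left m₁ m₂
  have := le_max_right m₁ m₂
  refine ⟨by linarith, h2, h1, ?_, le_max_of_le_left (by linarith), ?_, ?_, ?_⟩
  · linear_combination h.equation
  · linear_combination h.det₂₃
  · linear_combination -h.det₁₂
  · linear_combination 3 * m₁ * h.det₁₂ + h.det₃₁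

end MarkoffArc

/-- The arc containing the complementary interval `(φ, θ + 3)` has bounded denominators. -/
theorem MarkoffArc.gap_mul_sq_le {m₁ m₂ m₃ K₁ K₂ K₃ : ℤ} (h : MarkoffArc m₁ m₂ m₃ K₁ K₂ K₃)
    {θ φ : ℝ} (hw : φ - θ < 3)
    (hf : ∀ K m : ℤ, 0 < m → 1 ≤ |((K : ℝ) - θ * m) * (K - φ * m)|)
    (hφ : (K₁ : ℝ) < φ * m₁) (hθ : (θ + 3) * m₂ < (K₂ : ℝ)) :
    (3 - (φ - θ)) * (max m₁ m₂ : ℤ) ^ 2 ≤ 1 := by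
  have h1 : (0 : ℝ) < m₁ := by exact_mod_cast h.pos₁
  have h2 : (0 : ℝ) < m₂ := by exact_mod_cast h.pos₂
  have hd : (K₂ : ℝ) * m₁ - K₁ * m₂ = m₃ := by exact_mod_cast h.det₁₂
  have he : (m₁ : ℝ) ^ 2 + m₂ ^ 2 + m₃ ^ 2 = 3 * m₁ * m₂ * m₃ := by exact_mod_cast h.equation
  have hlower : ∀ K m : ℤ, 0 < m → 1 / (m : ℝ) ^ 2 ≤ |((K : ℝ) / m - θ) * (K / m - φ)| := by
    intro K m hm
    have hm' : (0 : ℝ) < m := by exact_mod_cast hm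
    have e : ((K : ℝ) - θ * m) * (K - φ * m) = m ^ 2 * ((K / m - θ) * (K / m - φ)) := by
      field_simp
    have := hf K m hm
    rw [e, abs_mul, abs_of_pos (by positivity)] at this
    rw [div_le_iff₀ (by positivity)]
    linarith
  have hA := hlower K₁ m₁ h.pos₁
  have hB := hlower (K₂ - 3 * m₂) m₂ h.pos₂
  have eB : ((K₂ - 3 * m₂ : ℤ) : ℝ) / m₂ = K₂ / m₂ - 3 := by
    push_cast
    field_simp
  rw [eB] at hB
  have hx : (K₁ : ℝ) / m₁ < φ := by rwa [div_lt_iff₀ h1]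
  have hy : θ + 3 < (K₂ : ℝ) / m₂ := by rwa [lt_div_iff₀ h2]
  have hℓ : (K₂ : ℝ) / m₂ - K₁ / m₁ = m₃ / (m₁ * m₂) := by
    rw [← hd]
    field_simp
  have hℓ1 : (m₃ : ℝ) / (m₁ * m₂) ≤ 1 := by
    rw [div_le_one (by positivity)]
    have := h.le_max
    have h1' := h.pos₁
    have h2' := h.pos₂
    exact_mod_cast this.trans (max_le (by nlinarith) (by nlinarith))
  -- The Markoff equation divided by (m₁m₂)²: a relation between the length of an arc and its end
  -- denominators.
  have hq : (m₃ : ℝ) / (m₁ * m₂) * (3 - m₃ / (m₁ * m₂)) = 1 / m₁ ^ 2 + 1 / m₂ ^ 2 := by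
    field_simp
    linear_combination -he
  rw [← hℓ] at hℓ1 hq
  generalize (K₁ : ℝ) / m₁ = t₁ at *
  generalize (K₂ : ℝ) / m₂ = t₂ at *
  rw [abs_of_neg (mul_neg_of_pos_of_neg (by linarith) (by linarith))] at hA hB
  have hδ₂ : 3 - (φ - θ) ≤ 1 / (m₂ : ℝ) ^ 2 :=
    gap_le (x := φ - t₁) (by linarith) (by linarith) (by linarith) hℓ1 (by linarith) hq
  have hδ₁ : 3 - (φ - θ) ≤ 1 / (m₁ : ℝ) ^ 2 :=
    gap_le (x := t₂ - (θ + 3)) (by linarith) (by linarith) (by linarith) hℓ1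
      (by linarith : 1 / (m₂ : ℝ) ^ 2 ≤ _) (by linarith)
  rcases le_total m₁ m₂ with hm | hm
  · rw [max_eq_right hm]
    rwa [le_div_iff₀ (by positivity)] at hδ₂
  · rw [max_eq_left hm]
    rwa [le_div_iff₀ (by positivity)] at hδ₁

theorem markoff_isolation_roots {θ φ : ℝ} {m K m₁ K₁ m₂ : ℤ}
    (hf : ∀ K m : ℤ, 0 < m → 1 ≤ |((K : ℝ) - θ * m) * (K - φ * m)|)
    (hm : 0 < m) (hm₁ : 0 < m₁) (hm₂ : 0 < m₂) (hθφ : θ < φ)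
    (hdet : K * m₁ - K₁ * m = m₂) (heq : m ^ 2 + m₁ ^ 2 + m₂ ^ 2 = 3 * m * m₁ * m₂)
    (h0 : φ * m ≤ K) (h3 : K - 3 * m ≤ θ * m)
    (hθ : θ * m₁ < K₁) (hφ : K₁ < φ * m₁) :
    (m : ℝ) ^ 2 * (φ - θ) ^ 2 = 9 * (m : ℝ) ^ 2 - 4 := by
  have hm' : (0 : ℝ) < m := by exact_mod_cast hm
  have hlt : θ * m < φ * m := mul_lt_mul_of_pos_right hθφ hm'
  have a0 := hf K m hm
  have a3 := hf (K - 3 * m) m hm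
  have a1 := hf K₁ m₁ hm₁
  push_cast at a3
  rw [abs_of_nonneg (mul_nonneg (by linarith) (by linarith))] at a0
  rw [abs_of_nonneg (mul_nonneg_of_nonpos_of_nonpos (by linarith) (by linarith))] at a3
  rw [abs_of_neg (mul_neg_of_pos_of_neg (by linarith) (by linarith))] at a1
  have := markoff_isolation (β := -(θ + φ)) (γ := θ * φ) (m := m) (K := K) (m₁ := m₁) (K₁ := K₁)
    (m₂ := m₂) hm' (by exact_mod_cast hm₁) (by exact_mod_cast hm₂) (by exact_mod_cast hdet)
    (by exact_mod_cast heq) (by linarith) (by linarith) (by linarith)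
  linarith

/-- Here n is fuel: the maximum of the denominators grows by at least 1 at each step, and once it
reaches N the bound on the gap is contradicted. Before that, the inserted fraction either falls in
the gap or selects the half that still contains it. -/
theorem MarkoffArc.descent {θ φ : ℝ} (hθφ : θ < φ) (hw : φ - θ < 3)
    (hf : ∀ K m : ℤ, 0 < m → 1 ≤ |((K : ℝ) - θ * m) * (K - φ * m)|) {N : ℤ}
    (hN : 1 < (3 - (φ - θ)) * (N : ℝ) ^ 2) (hN0 : 0 < N) (n : ℕ) :
    ∀ m₁ m₂ m₃ K₁ K₂ K₃ : ℤ, MarkoffArc m₁ m₂ m₃ K₁ K₂ K₃ → N ≤ n + max m₁ m₂ →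
      (K₁ : ℝ) < φ * m₁ → (θ + 3) * m₂ < (K₂ : ℝ) →
      ∃ m : ℤ, 0 < m ∧ (m : ℝ) ^ 2 * (φ - θ) ^ 2 = 9 * (m : ℝ) ^ 2 - 4 := by
  induction n with
  | zero =>
    intro m₁ m₂ m₃ K₁ K₂ K₃ h hn hφ hθ
    have h1 := h.gap_mul_sq_le hw hf hφ hθ
    have h2 : (N : ℝ) ≤ (max m₁ m₂ : ℤ) := by exact_mod_cast (by simpa using hn : N ≤ max m₁ m₂)
    have h3 : (0 : ℝ) < N := by exact_mod_cast hN0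
    have := mul_le_mul_of_nonneg_left (pow_le_pow_left₀ h3.le h2 2)
      (by linarith : 0 ≤ 3 - (φ - θ))
    linarith
  | succ n ih =>
    intro m₁ m₂ m₃ K₁ K₂ K₃ h hn hφ hθ
    have h1 := h.pos₁
    have hmax := h.two_mul_max_le
    have hl := le_max_left m₁ m₂
    have hleft := h.left
    have hright := h.right
    have hK : (3 * m₁ * K₂ - K₃) * m₁ - K₁ * (3 * m₁ * m₂ - m₃) = m₂ := hleft.det₁₂
    generalize 3 * m₁ * m₂ - m₃ = m at *
    generalize 3 * m₁ * K₂ - K₃ = K at *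
    have hn' : N ≤ n + m := by push_cast at hn; linarith
    by_cases hK1 : (K : ℝ) < φ * m
    · exact ih _ _ _ _ _ _ hright (hn'.trans (by have := le_max_left m m₂; linarith)) hK1 hθ
    by_cases hK2 : (θ + 3) * m < (K : ℝ)
    · exact ih _ _ _ _ _ _ hleft (hn'.trans (by have := le_max_right m₁ m; linarith)) hφ hK2
    refine ⟨m, hleft.pos₂, markoff_isolation_roots hf hleft.pos₂ h1 h.pos₂ hθφ hK ?_
      (not_lt.1 hK1) (by linarith) ?_ hφ⟩
    · linear_combination hleft.equation
    · have h1' : (0 : ℝ) < m₁ := by exact_mod_cast h1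
      have h2' : (0 : ℝ) < m₂ := by exact_mod_cast h.pos₂
      have hd : (K₂ : ℝ) * m₁ - K₁ * m₂ = m₃ := by exact_mod_cast h.det₁₂
      have h3 : (m₃ : ℝ) ≤ m₁ * m₂ := by
        have h2 := h.pos₂
        exact_mod_cast h.le_max.trans (max_le (by nlinarith) (by nlinarith))
      have h4 : (θ + 3) * m₂ * m₁ < K₂ * m₁ := mul_lt_mul_of_pos_right hθ h1'
      have h5 : θ * m₁ * m₂ < K₁ * m₂ := by nlinarith [mul_pos h1' h2']
      exact lt_of_mul_lt_mul_right h5 h2'.le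

/-- Markoff's theorem, weak form, for the normalised form `(x - θ y)(x - φ y)`. -/
theorem exists_markoff_discriminant {θ φ : ℝ} (hθφ : θ < φ) (hw : φ - θ < 3)
    (hf : ∀ K m : ℤ, 0 < m → 1 ≤ |((K : ℝ) - θ * m) * (K - φ * m)|) :
    ∃ m : ℤ, 0 < m ∧ (m : ℝ) ^ 2 * (φ - θ) ^ 2 = 9 * (m : ℝ) ^ 2 - 4 := by
  set n : ℤ := ⌈φ⌉ - 1 with hn
  have hn1 : (n : ℝ) < φ := by
    have := Int.ceil_lt_add_one φ
    rw [hn]; push_cast; linarith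
  have hn2 : φ ≤ n + 1 := by
    have := Int.le_ceil φ
    rw [hn]; push_cast; linarith
  by_cases h : θ + 3 < n + 1
  · obtain ⟨N, hN⟩ := exists_nat_gt (1 / (3 - (φ - θ)) + 1)
    have hδ : 0 < 3 - (φ - θ) := by linarith
    have hpos : 0 < 1 / (3 - (φ - θ)) := by positivity
    have hN1 : (1 : ℝ) < N := by linarith
    have hN2 : 1 < (3 - (φ - θ)) * ((N : ℤ) : ℝ) ^ 2 := by
      have : 1 / (3 - (φ - θ)) < (N : ℝ) ^ 2 := by nlinarith
      rw [div_lt_iff₀ hδ] at this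
      push_cast
      linarith
    refine MarkoffArc.descent hθφ hw hf hN2 (by exact_mod_cast (by linarith : (0 : ℝ) < N)) N
      1 1 1 n (n + 1) (n + 2) (MarkoffArc.base n) (by simp) (by simpa using hn1) ?_
    push_cast
    linarith
  -- The integer n + 1 already lies in the gap. If θ ≥ n, both roots lie in [n, n + 1], and f(n, 1)
  -- would be less than 1.
  · have hθn : θ < n := by
      by_contra! hc
      have := hf n 1 one_pos
      push_cast at this
      rw [abs_of_nonneg (mul_nonneg_of_nonpos_of_nonpos (by linarith) (by linarith))] at this
      nlinarith
    refine ⟨1, one_pos, markoff_isolation_roots hf (K := n + 1) (K₁ := n) (m₁ := 1) (m₂ := 1)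
      one_pos one_pos one_pos hθφ (by ring) (by norm_num) ?_ ?_ ?_ ?_⟩ <;> push_cast <;> linarith

/-! ### The quadratic spectrum above 1/3 -/

theorem markoffConstant_eq_of_isLeast {a b c μ : ℝ}
    (hle : ∀ x y : ℤ, (x, y) ≠ (0, 0) → μ ≤ |a * x ^ 2 + b * x * y + c * y ^ 2|)
    (hmem : ∃ x y : ℤ, (x, y) ≠ (0, 0) ∧ μ = |a * x ^ 2 + b * x * y + c * y ^ 2|) :
    markoffConstant a b c = μ / √(b ^ 2 - 4 * a * c) := by
  have : IsLeast {t : ℝ | ∃ x y : ℤ, (x, y) ≠ (0, 0) ∧ t = |a * x ^ 2 + b * x * y + c * y ^ 2|} μ :=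
    ⟨hmem, by rintro t ⟨x, y, hxy, rfl⟩; exact hle x y hxy⟩
  rw [markoffConstant, this.csInf_eq]

/-- An integral form attains its minimum over the nonzero integer vectors. -/
theorem exists_min_intForm (a b c : ℤ) : ∃ x₀ y₀ : ℤ, (x₀, y₀) ≠ (0, 0) ∧
    ∀ x y : ℤ, (x, y) ≠ (0, 0) →
      |a * x₀ ^ 2 + b * x₀ * y₀ + c * y₀ ^ 2| ≤ |a * x ^ 2 + b * x * y + c * y ^ 2| := by
  let v : ℤ × ℤ → ℕ := fun p => (a * p.1 ^ 2 + b * p.1 * p.2 + c * p.2 ^ 2).natAbs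
  obtain ⟨p, hp, hmin⟩ := (measure v).wf.has_min {p : ℤ × ℤ | p ≠ (0, 0)} ⟨(1, 0), by simp⟩
  refine ⟨p.1, p.2, hp, fun x y hxy => ?_⟩
  have : v p ≤ v (x, y) := not_lt.1 (hmin (x, y) hxy)
  rw [Int.abs_eq_natAbs, Int.abs_eq_natAbs]
  exact_mod_cast this

/-- Values of the quadratic spectrum above `1/3` belong to the sequence `m / √(9m² - 4)`. -/
theorem exists_eq_of_mem_quadraticMarkoffSpectrum {C : ℝ} (hC : C ∈ quadraticMarkoffSpectrum)
    (h3 : 1 / 3 < C) : ∃ m : ℤ, 0 < m ∧ C ^ 2 * (9 * (m : ℝ) ^ 2 - 4) = (m : ℝ) ^ 2 := by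
  obtain ⟨a, b, c, hΔ, rfl⟩ := hC
  obtain ⟨x₀, y₀, h0, hmin⟩ := exists_min_intForm a b c
  set ν : ℤ := a * x₀ ^ 2 + b * x₀ * y₀ + c * y₀ ^ 2 with hν
  have hconst : markoffConstant a b c = (|ν| : ℤ) / √((b : ℝ) ^ 2 - 4 * a * c) := by
    refine markoffConstant_eq_of_isLeast (fun x y hxy => ?_) ⟨x₀, y₀, h0, ?_⟩
    · exact_mod_cast hmin x y hxy
    · rw [hν]; push_cast; rfl
  have hΔ' : (0 : ℝ) < (b : ℝ) ^ 2 - 4 * a * c := by exact_mod_cast hΔ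
  have hν0 : ν ≠ 0 := by
    intro h
    rw [hconst, h] at h3
    norm_num at h3
  have hsq : (markoffConstant a b c) ^ 2 = (ν : ℝ) ^ 2 / ((b : ℝ) ^ 2 - 4 * a * c) := by
    rw [hconst, div_pow, Real.sq_sqrt hΔ'.le]
    push_cast
    rw [sq_abs]
  have hν' : (0 : ℝ) < (ν : ℝ) ^ 2 := by positivity
  have hlt : (b : ℝ) ^ 2 - 4 * a * c < 9 * (ν : ℝ) ^ 2 := by
    have h : (1 / 3 : ℝ) ^ 2 < markoffConstant a b c ^ 2 := by gcongr
    rw [hsq, lt_div_iff₀ hΔ'] at h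
    linarith
  -- a minimal vector is primitive
  have hgcd : IsCoprime x₀ y₀ := by
    rw [Int.isCoprime_iff_gcd_eq_one]
    have hg0 : 0 < Int.gcd x₀ y₀ := by
      rw [Int.gcd_pos_iff]
      by_contra! h
      exact h0 (by rw [h.1, h.2])
    obtain ⟨g, x, y, hg, hcop, hx, hy⟩ := Int.exists_gcd_one' hg0
    have hxy : (x, y) ≠ (0, 0) := by
      rintro h
      simp only [Prod.mk.injEq] at h
      exact h0 (by rw [hx, hy, h.1, h.2]; simp)
    have hval : ν = g ^ 2 * (a * x ^ 2 + b * x * y + c * y ^ 2) := by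
      rw [hν, hx, hy]; ring
    have hle := hmin x y hxy
    have hw : 0 < |a * x ^ 2 + b * x * y + c * y ^ 2| := (abs_pos.2 hν0).trans_le hle
    rw [hval, abs_mul, abs_of_nonneg (by positivity : (0 : ℤ) ≤ (g : ℤ) ^ 2)] at hle
    have hg1 : g = 1 := by
      have h1 : (g : ℤ) ^ 2 ≤ 1 := by
        by_contra! h
        nlinarith
      have h2 : (g : ℤ) ≤ 1 := by nlinarith
      omega
    rw [hg1, Nat.cast_one, mul_one] at hx hy
    rw [hx, hy, hcop]
  obtain ⟨u, v, huv⟩ := hgcd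
  -- Coefficients of the form in the basis (x₀, y₀), (-v, u), whose determinant is 1; the leading
  -- one is the minimal value ν.
  set β : ℤ := -2 * a * x₀ * v + b * (x₀ * u - y₀ * v) + 2 * c * y₀ * u with hβ
  set γ : ℤ := a * v ^ 2 - b * v * u + c * u ^ 2 with hγ
  have hform : ∀ K m : ℤ, a * (x₀ * K - v * m) ^ 2 + b * (x₀ * K - v * m) * (y₀ * K + u * m) +
      c * (y₀ * K + u * m) ^ 2 = ν * K ^ 2 + β * K * m + γ * m ^ 2 := by
    intro K m; rw [hν, hβ, hγ]; ring
  have hdisc : β ^ 2 - 4 * ν * γ = b ^ 2 - 4 * a * c := by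
    have : β ^ 2 - 4 * ν * γ = (u * x₀ + v * y₀) ^ 2 * (b ^ 2 - 4 * a * c) := by
      rw [hν, hβ, hγ]; ring
    rw [this, huv]; ring
  have hdisc' : (β : ℝ) ^ 2 - 4 * ν * γ = (b : ℝ) ^ 2 - 4 * a * c := by exact_mod_cast hdisc
  set s : ℝ := √((b : ℝ) ^ 2 - 4 * a * c) with hs
  have hs2 : s ^ 2 = (b : ℝ) ^ 2 - 4 * a * c := Real.sq_sqrt hΔ'.le
  have hs0 : 0 < s := Real.sqrt_pos.2 hΔ'
  have hνabs : (0 : ℝ) < |(ν : ℝ)| := by positivity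
  have hνr : (ν : ℝ) ≠ 0 := by exact_mod_cast hν0
  have hsν : s / |(ν : ℝ)| < 3 := by
    rw [div_lt_iff₀ hνabs]
    refine lt_of_pow_lt_pow_left₀ 2 (by positivity) ?_
    rw [hs2, mul_pow, sq_abs]
    linarith
  have hfac : ∀ K m : ℤ, ((K : ℝ) - (-β / (2 * ν) - s / (2 * |(ν : ℝ)|)) * m) *
      (K - (-β / (2 * ν) + s / (2 * |(ν : ℝ)|)) * m) =
      (ν * K ^ 2 + β * K * m + γ * m ^ 2 : ℤ) / ν := by
    intro K m
    have e : (s / (2 * |(ν : ℝ)|)) ^ 2 = (β ^ 2 - 4 * ν * γ) / (4 * ν ^ 2) := by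
      rw [div_pow, hs2, mul_pow, sq_abs, hdisc']; norm_num
    calc _ = ((K : ℝ) + β / (2 * ν) * m) ^ 2 - (s / (2 * |(ν : ℝ)|)) ^ 2 * m ^ 2 := by ring
      _ = _ := by
        rw [e]
        push_cast
        field_simp
        ring
  have hlen : (-β / (2 * ν) + s / (2 * |(ν : ℝ)|)) - (-β / (2 * ν) - s / (2 * |(ν : ℝ)|)) =
      s / |(ν : ℝ)| := by
    field_simp
    ring
  have hspos : 0 < s / |(ν : ℝ)| := by positivity
  obtain ⟨m, hm, hmeq⟩ := exists_markoff_discriminant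
    (θ := -β / (2 * ν) - s / (2 * |(ν : ℝ)|)) (φ := -β / (2 * ν) + s / (2 * |(ν : ℝ)|))
    (by linarith) (by linarith) (by
      intro K m hm
      rw [hfac, abs_div, le_div_iff₀ hνabs, one_mul, ← hform]
      have := hmin (x₀ * K - v * m) (y₀ * K + u * m) (by
        intro h
        simp only [Prod.mk.injEq] at h
        have : m = 0 := by linear_combination x₀ * h.2 - y₀ * h.1 - m * huv
        exact hm.ne' this)
      exact_mod_cast this)
  refine ⟨m, hm, ?_⟩
  rw [hlen, div_pow, hs2, sq_abs] at hmeq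
  rw [hsq, ← hmeq]
  field_simp

/-- Above `1/3`, the quadratic Markoff spectrum accumulates nowhere. -/
theorem le_of_accPt_quadraticMarkoffSpectrum {x : ℝ} (hx : AccPt x (𝓟 quadraticMarkoffSpectrum)) :
    x ≤ 1 / 3 := by
  by_contra! h
  obtain ⟨r, hr, hrx⟩ := exists_between h
  have hinf := Set.Infinite.of_accPt (hx.nhds_inter (Ioi_mem_nhds hrx))
  -- C > r gives m²(9r² - 1) < 4r², and with m ≥ 1 the same bound holds for m.
  obtain ⟨M, hM⟩ := exists_nat_gt (4 * r ^ 2 / (9 * r ^ 2 - 1))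
  have hr0 : 0 < 9 * r ^ 2 - 1 := by nlinarith
  refine hinf (((Set.finite_Icc (0 : ℤ) M).image
    fun m : ℤ => √((m : ℝ) ^ 2 / (9 * (m : ℝ) ^ 2 - 4))).subset ?_)
  rintro C ⟨hCr, hC⟩
  have hCr' : r < C := hCr
  obtain ⟨m, hm, hmeq⟩ := exists_eq_of_mem_quadraticMarkoffSpectrum hC (hr.trans hCr')
  have hm1 : (1 : ℝ) ≤ m := by exact_mod_cast hm
  have hpos : 0 < 9 * (m : ℝ) ^ 2 - 4 := by nlinarith
  refine ⟨m, ⟨hm.le, ?_⟩, ?_⟩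
  · by_contra! hMm
    have hMm' : (M : ℝ) < m := by exact_mod_cast hMm
    have h1 : 4 * r ^ 2 / (9 * r ^ 2 - 1) < m := hM.trans hMm'
    rw [div_lt_iff₀ hr0] at h1
    have h2 : r ^ 2 * (9 * (m : ℝ) ^ 2 - 4) < m ^ 2 := by
      calc r ^ 2 * (9 * (m : ℝ) ^ 2 - 4) < C ^ 2 * (9 * (m : ℝ) ^ 2 - 4) := by
            have : (0 : ℝ) < r := by linarith
            gcongr
        _ = (m : ℝ) ^ 2 := hmeq
    nlinarith [mul_le_mul_of_nonneg_right hm1 (by nlinarith : 0 ≤ (m : ℝ) * (9 * r ^ 2 - 1))]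
  · simp only
    rw [show (m : ℝ) ^ 2 / (9 * (m : ℝ) ^ 2 - 4) = C ^ 2 by rw [div_eq_iff hpos.ne', hmeq]]
    exact Real.sqrt_sq (by linarith)

/-! ### Minima of the classical forms of (p, 1, q) -/

theorem golden_norm_ne_zero {x y : ℤ} (h : (x, y) ≠ (0, 0)) : x ^ 2 - 3 * x * y + y ^ 2 ≠ 0 := by
  intro h0
  have h5 : (2 * x - 3 * y) ^ 2 = 5 * y ^ 2 := by linear_combination 4 * h0
  rcases eq_or_ne y 0 with rfl | hy
  · have : x = 0 := by simpa using h0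
    exact h (by rw [this])
  · have hirr := Nat.Prime.irrational_sqrt (show Nat.Prime 5 by norm_num)
    refine hirr ⟨|(2 * x - 3 * y : ℚ)| / |(y : ℚ)|, ?_⟩
    have hy' : (y : ℝ) ≠ 0 := by exact_mod_cast hy
    have h5' : (2 * (x : ℝ) - 3 * y) ^ 2 = 5 * y ^ 2 := by exact_mod_cast h5
    push_cast
    rw [eq_comm, Real.sqrt_eq_iff_mul_self_eq (by norm_num) (by positivity), ← abs_div,
      abs_mul_abs_self, div_mul_div_comm, ← sq, ← sq, h5']
    field_simp

section Classical

variable {p q : ℤ}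

/-- On the lattice, p² times the golden norm of (x, b) is a² - (3p - 2q)ab - b², so this has
absolute value at least p². For a, b ≥ 0 it is dominated, with either sign, by the form a² + 3pab +
b². -/
theorem sq_le_of_reduced {a b x : ℤ} (hp : 0 < p) (hq0 : 0 ≤ q) (hq : 2 * q ≤ 3 * p)
    (hpq : p ^ 2 + q ^ 2 - 3 * p * q = -1) (hx : p * x = a + q * b) (ha : 0 ≤ a) (hb : 0 ≤ b)
    (hab : (a, b) ≠ (0, 0)) : p ^ 2 ≤ a ^ 2 + 3 * p * a * b + b ^ 2 := by
  have hN : p ^ 2 * (x ^ 2 - 3 * x * b + b ^ 2) = a ^ 2 - (3 * p - 2 * q) * (a * b) - b ^ 2 := by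
    linear_combination (p * x + a + q * b - 3 * p * b) * hx + b ^ 2 * hpq
  have hab' := mul_nonneg ha hb
  have h1 : 0 ≤ q * (a * b) := mul_nonneg hq0 hab'
  have h2 : 0 ≤ p * (a * b) := mul_nonneg hp.le hab'
  have hp2 : 0 < p ^ 2 := by positivity
  have hxb : (x, b) ≠ (0, 0) := by
    intro h
    simp only [Prod.mk.injEq] at h
    rw [h.1, h.2] at hx
    exact hab (by rw [h.2, show a = 0 by linarith])
  rcases lt_or_gt_of_ne (golden_norm_ne_zero hxb) with h | h
  · have : p ^ 2 * (x ^ 2 - 3 * x * b + b ^ 2 + 1) ≤ 0 :=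
      mul_nonpos_of_nonneg_of_nonpos hp2.le (by linarith)
    nlinarith [sq_nonneg a]
  · have : p ^ 2 * 1 ≤ p ^ 2 * (x ^ 2 - 3 * x * b + b ^ 2) :=
      mul_le_mul_of_nonneg_left (by linarith) hp2.le
    nlinarith [sq_nonneg b, mul_nonneg (sub_nonneg.2 hq) hab']

/-- The automorph (a, b) ↦ (-b, a + 3pb) or its inverse, up to sign, shortens a pair of mixed signs.
Both preserve the lattice because q² ≡ -1 (mod p). -/
theorem exists_smaller_pair {a b x : ℤ} (hp : 0 < p) (hpq : p ^ 2 + q ^ 2 - 3 * p * q = -1)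
    (hx : p * x = a + q * b) (ha : a < 0) (hb : 0 < b) (hQ : 0 ≤ a ^ 2 + 3 * p * a * b + b ^ 2) :
    ∃ a' b' x' : ℤ, p * x' = a' + q * b' ∧ |a'| + |b'| < |a| + |b| ∧ (a', b') ≠ (0, 0) ∧
      a' ^ 2 + 3 * p * a' * b' + b' ^ 2 = a ^ 2 + 3 * p * a * b + b ^ 2 := by
  rcases le_or_gt b (-a) with h | h
  · refine ⟨-b, a + 3 * p * b, q * x + p * b, ?_, ?_, ?_, by ring⟩
    · linear_combination q * hx + b * hpq
    · have h1 : a + 3 * p * b < b := by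
        by_contra! hc
        nlinarith [mul_nonneg (sub_nonneg.2 hc) (neg_nonneg.2 ha.le),
          mul_nonneg (sub_nonneg.2 h) hb.le, mul_pos hb hb, mul_pos hp (mul_pos hb hb)]
      have h2 : 0 < p * b := mul_pos hp hb
      rw [abs_neg, abs_of_pos hb, abs_of_neg ha, add_comm, add_lt_add_iff_right, abs_lt]
      constructor <;> linarith
    · intro h0
      simp only [Prod.mk.injEq] at h0
      linarith [h0.1]
  · refine ⟨b + 3 * p * a, -a, (3 * p - q) * x - p * b, ?_, ?_, ?_, by ring⟩
    · linear_combination (3 * p - q) * hx + (-b) * hpq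
    · have h1 : -(b + 3 * p * a) < -a := by
        by_contra! hc
        nlinarith [mul_nonneg (sub_nonneg.2 hc) hb.le, mul_pos (sub_pos.2 h) hb,
          mul_pos (sub_pos.2 h) (neg_pos.2 ha)]
      have h2 : p * a < 0 := mul_neg_of_pos_of_neg hp ha
      rw [abs_neg, abs_of_pos hb, abs_of_neg ha, add_comm, add_lt_add_iff_left, abs_lt]
      constructor <;> linarith
    · intro h0
      simp only [Prod.mk.injEq] at h0
      linarith [h0.2]

theorem sq_le_of_lattice (hp : 0 < p) (hq0 : 0 ≤ q) (hq : 2 * q ≤ 3 * p)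
    (hpq : p ^ 2 + q ^ 2 - 3 * p * q = -1) (n : ℕ) :
    ∀ a b x : ℤ, |a| + |b| ≤ n → p * x = a + q * b → (a, b) ≠ (0, 0) →
      0 ≤ a ^ 2 + 3 * p * a * b + b ^ 2 → p ^ 2 ≤ a ^ 2 + 3 * p * a * b + b ^ 2 := by
  induction n with
  | zero =>
    intro a b x hn hx hab hQ
    have h1 := abs_nonneg a
    have h2 := abs_nonneg b
    push_cast at hn
    exact absurd (by rw [abs_eq_zero.1 (by linarith : |a| = 0),
      abs_eq_zero.1 (by linarith : |b| = 0)]) hab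
  | succ n ih =>
    intro a b x hn hx hab hQ
    push_cast at hn
    have hneg : a ^ 2 + 3 * p * a * b + b ^ 2 = (-a) ^ 2 + 3 * p * (-a) * (-b) + (-b) ^ 2 := by ring
    have hab' : (-a, -b) ≠ (0, 0) := by simpa using hab
    rcases le_or_gt 0 a with ha | ha <;> rcases le_or_gt 0 b with hb | hb
    · exact sq_le_of_reduced hp hq0 hq hpq hx ha hb hab
    · rcases ha.eq_or_lt with rfl | ha
      · rw [hneg]
        exact sq_le_of_reduced (x := -x) hp hq0 hq hpq (by linarith) (by simp) (by linarith) hab'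
      · obtain ⟨a', b', x', h1, h2, h3, h4⟩ := exists_smaller_pair (a := -a) (b := -b) (x := -x)
          hp hpq (by linarith) (by linarith) (by linarith) (by rwa [← hneg])
        rw [hneg] at hQ ⊢
        rw [← h4] at hQ ⊢
        rw [abs_neg, abs_neg] at h2
        exact ih a' b' x' (by linarith) h1 h3 hQ
    · rcases hb.eq_or_lt with rfl | hb
      · rw [hneg]
        exact sq_le_of_reduced (x := -x) hp hq0 hq hpq (by linarith) (by linarith) (by simp) hab'
      · obtain ⟨a', b', x', h1, h2, h3, h4⟩ := exists_smaller_pair hp hpq hx ha hb hQ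
        rw [← h4] at hQ ⊢
        exact ih a' b' x' (by linarith) h1 h3 hQ
    · rw [hneg]
      exact sq_le_of_reduced (x := -x) hp hq0 hq hpq (by linarith) (by linarith) (by linarith) hab'

/-- The Markoff form attached to `(p, 1, q)` takes its minimum `p` at `(1, 0)`. -/
theorem le_abs_classicalForm (hp : 0 < p) (hq0 : 0 ≤ q) (hq : 2 * q ≤ 3 * p)
    (hpq : p ^ 2 + q ^ 2 - 3 * p * q = -1) {x y : ℤ} (hxy : (x, y) ≠ (0, 0)) :
    p ≤ |p * x ^ 2 + (3 * p - 2 * q) * x * y - p * y ^ 2| := by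
  have key : ∀ x y : ℤ, (x, y) ≠ (0, 0) → 0 ≤ p * x ^ 2 + (3 * p - 2 * q) * x * y - p * y ^ 2 →
      p ≤ p * x ^ 2 + (3 * p - 2 * q) * x * y - p * y ^ 2 := by
    intro x y hxy h0
    have e : (p * x - q * y) ^ 2 + 3 * p * (p * x - q * y) * y + y ^ 2 =
        p * (p * x ^ 2 + (3 * p - 2 * q) * x * y - p * y ^ 2) := by
      linear_combination y ^ 2 * hpq
    have := sq_le_of_lattice hp hq0 hq hpq (|p * x - q * y| + |y|).toNat (p * x - q * y) y x
      (Int.self_le_toNat _) (by ring) (by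
        intro h
        simp only [Prod.mk.injEq] at h
        have h1 := h.1
        rw [h.2, mul_zero, sub_zero] at h1
        exact hxy (by rw [h.2, (mul_eq_zero.1 h1).resolve_left hp.ne']))
      (by rw [e]; exact mul_nonneg hp.le h0)
    rw [e, sq] at this
    exact le_of_mul_le_mul_left this hp
  rcases le_total 0 (p * x ^ 2 + (3 * p - 2 * q) * x * y - p * y ^ 2) with h | h
  · exact (key x y hxy h).trans (le_abs_self _)
  -- The quarter turn (x, y) ↦ (-y, x) negates the form, so negative values reduce to positive ones.
  · have e : p * (-y) ^ 2 + (3 * p - 2 * q) * (-y) * x - p * x ^ 2 =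
        -(p * x ^ 2 + (3 * p - 2 * q) * x * y - p * y ^ 2) := by ring
    have := key (-y) x (by
      intro h'
      simp only [Prod.mk.injEq, neg_eq_zero] at h'
      exact hxy (by rw [h'.1, h'.2])) (by rw [e]; linarith)
    rw [e] at this
    exact this.trans (neg_le_abs _)

end Classical

/-! ### Minima of the forms below 1/3 -/

section Lower

variable {P Q : ℤ}

/-- The two signs of the middle coefficient are treated together because the reduction swaps them.
Two decompositions, one with m·N and one with -(m - 2)·N for m = P² + Q², settle everything outside
a narrow cone around a root; inside it, a unimodular substitution yields a smaller vector for the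
companion form. -/
theorem le_abs_lowerForm_aux (hQ : 0 < Q) (h7 : 7 * Q ≤ 3 * P) (h3 : P ≤ 3 * Q)
    (hPQ : P ^ 2 - 3 * P * Q + Q ^ 2 = 1) (n : ℕ) :
    ∀ s t : ℤ, 0 ≤ s → 0 ≤ t → (s, t) ≠ (0, 0) → s + t ≤ n →
      P ^ 2 + Q ^ 2 - 2 ≤
        |(P ^ 2 + Q ^ 2) * s ^ 2 - 3 * (P ^ 2 - Q ^ 2) * s * t - (P ^ 2 + Q ^ 2 - 2) * t ^ 2| ∧
      P ^ 2 + Q ^ 2 - 2 ≤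
        |(P ^ 2 + Q ^ 2) * s ^ 2 + 3 * (P ^ 2 - Q ^ 2) * s * t -
          (P ^ 2 + Q ^ 2 - 2) * t ^ 2| := by
  have hP : 0 < P := by linarith
  have hm : 2 ≤ P ^ 2 + Q ^ 2 := by nlinarith
  induction n with
  | zero =>
    intro s t hs ht hst hn
    push_cast at hn
    exact absurd (by rw [show s = 0 by linarith, show t = 0 by linarith]) hst
  | succ n ih =>
    intro s t hs ht hst hn
    push_cast at hn
    have hN := golden_norm_ne_zero hst
    set N := s ^ 2 - 3 * s * t + t ^ 2 with hNdef
    constructor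
    · have e1 : (P ^ 2 + Q ^ 2) * s ^ 2 - 3 * (P ^ 2 - Q ^ 2) * s * t -
          (P ^ 2 + Q ^ 2 - 2) * t ^ 2 =
          (P ^ 2 + Q ^ 2) * N + 6 * ((Q * t) * (Q * s - P * t)) := by
        rw [hNdef]; linear_combination -2 * t ^ 2 * hPQ
      have e2 : (P ^ 2 + Q ^ 2) * s ^ 2 - 3 * (P ^ 2 - Q ^ 2) * s * t -
          (P ^ 2 + Q ^ 2 - 2) * t ^ 2 =
          -((P ^ 2 + Q ^ 2 - 2) * N) + 6 * ((Q * s) * (P * s - (3 * P - Q) * t)) := by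
        rw [hNdef]; linear_combination (2 * s ^ 2 - 6 * s * t) * hPQ
      rcases lt_or_gt_of_ne hN with h | h
      -- P/Q lies beyond the larger root of the golden norm, whose value at (P, Q) is 1, so N < 0
      -- forces s/t ≤ P/Q.
      · have h1 : Q * s ≤ P * t := by
          by_contra! hc
          have hN' : Q ^ 2 * N = t ^ 2 + (2 * P - 3 * Q) * t * (Q * s - P * t) +
              (Q * s - P * t) ^ 2 := by
            rw [hNdef]; linear_combination t ^ 2 * hPQ
          have h2 : 0 ≤ (2 * P - 3 * Q) * t * (Q * s - P * t) :=
            mul_nonneg (mul_nonneg (by linarith) ht) (by linarith)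
          have h3 : 0 < (Q * s - P * t) ^ 2 := pow_pos (by linarith) 2
          have h4 : Q ^ 2 * N < 0 := mul_neg_of_pos_of_neg (by positivity) h
          linarith [sq_nonneg t]
        refine le_trans ?_ (neg_le_abs _)
        rw [e1]
        have h2 : 0 ≤ (Q * t) * (P * t - Q * s) := mul_nonneg (by positivity) (by linarith)
        have h3 : 0 ≤ (P ^ 2 + Q ^ 2) * (-1 - N) := mul_nonneg (by positivity) (by linarith)
        linarith
      · rcases le_or_gt (P * t) (Q * s) with h1 | h1
        · refine le_trans ?_ (le_abs_self _)
          rw [e1]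
          have h2 : 0 ≤ (Q * t) * (Q * s - P * t) := mul_nonneg (by positivity) (by linarith)
          have h3 : 0 ≤ (P ^ 2 + Q ^ 2) * (N - 1) := mul_nonneg (by positivity) (by linarith)
          linarith
        rcases le_or_gt (P * s) ((3 * P - Q) * t) with h2 | h2
        · refine le_trans ?_ (neg_le_abs _)
          rw [e2]
          have h3 : 0 ≤ (Q * s) * ((3 * P - Q) * t - P * s) :=
            mul_nonneg (by positivity) (by linarith)
          have h4 : 0 ≤ (P ^ 2 + Q ^ 2 - 2) * (N - 1) := mul_nonneg (by linarith) (by linarith)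
          linarith
        -- What remains is the open cone spanned by (P, Q) and (3P - Q, P), a basis of determinant
        -- 1; i and j are the coordinates in it.
        obtain ⟨i, hi⟩ : ∃ i, i = P * s - (3 * P - Q) * t := ⟨_, rfl⟩
        obtain ⟨j, hj⟩ : ∃ j, j = P * t - Q * s := ⟨_, rfl⟩
        have hs' : s = P * i + (3 * P - Q) * j := by
          rw [hi, hj]; linear_combination -s * hPQ
        have ht' : t = Q * i + P * j := by
          rw [hi, hj]; linear_combination -t * hPQ
        have hi0 : 0 < i := by linarith
        have hj0 : 0 < j := by linarith
        have hlt : i + j < s + t := by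
          rw [hs', ht']
          nlinarith
        refine (ih i j hi0.le hj0.le (by simp [hi0.ne']) (by linarith)).2.trans_eq ?_
        congr 1
        rw [hs', ht']
        linear_combination -(2 * j ^ 2 + (P ^ 2 + Q ^ 2) * (i ^ 2 + 3 * i * j + j ^ 2) -
          6 * Q * (Q * i + P * j) * j - 2 * (Q * i + P * j) ^ 2) * hPQ
    · have e1 : (P ^ 2 + Q ^ 2) * s ^ 2 + 3 * (P ^ 2 - Q ^ 2) * s * t -
          (P ^ 2 + Q ^ 2 - 2) * t ^ 2 =
          (P ^ 2 + Q ^ 2) * N + 6 * ((P * t) * (P * s - Q * t)) := by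
        rw [hNdef]; linear_combination -2 * t ^ 2 * hPQ
      have e2 : (P ^ 2 + Q ^ 2) * s ^ 2 + 3 * (P ^ 2 - Q ^ 2) * s * t -
          (P ^ 2 + Q ^ 2 - 2) * t ^ 2 =
          -((P ^ 2 + Q ^ 2 - 2) * N) + 6 * ((P * s) * (Q * s - (3 * Q - P) * t)) := by
        rw [hNdef]; linear_combination (2 * s ^ 2 - 6 * s * t) * hPQ
      rcases lt_or_gt_of_ne hN with h | h
      · have h1 : (3 * Q - P) * t ≤ Q * s := by
          by_contra! hc
          have hN' : (3 * Q - P) ^ 2 * N = s ^ 2 +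
              (2 * Q - 3 * (3 * Q - P)) * s * ((3 * Q - P) * t - Q * s) +
              ((3 * Q - P) * t - Q * s) ^ 2 := by
            rw [hNdef]; linear_combination s ^ 2 * hPQ
          -- The coefficient is 3P - 7Q, hence the hypothesis `h7`.
          have h2 : 0 ≤ (2 * Q - 3 * (3 * Q - P)) * s * ((3 * Q - P) * t - Q * s) :=
            mul_nonneg (mul_nonneg (by linarith) hs) (by linarith)
          have h3 : 0 < ((3 * Q - P) * t - Q * s) ^ 2 := pow_pos (by linarith) 2
          have h4 : (3 * Q - P) ^ 2 * N ≤ 0 :=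
            mul_nonpos_of_nonneg_of_nonpos (by positivity) h.le
          linarith [sq_nonneg s]
        refine le_trans ?_ (le_abs_self _)
        rw [e2]
        have h2 : 0 ≤ (P * s) * (Q * s - (3 * Q - P) * t) :=
          mul_nonneg (by positivity) (by linarith)
        have h3 : 0 ≤ (P ^ 2 + Q ^ 2 - 2) * (-1 - N) := mul_nonneg (by linarith) (by linarith)
        linarith
      · rcases le_or_gt (Q * s) ((3 * Q - P) * t) with h1 | h1
        · refine le_trans ?_ (neg_le_abs _)
          rw [e2]
          have h2 : 0 ≤ (P * s) * ((3 * Q - P) * t - Q * s) :=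
            mul_nonneg (by positivity) (by linarith)
          have h3 : 0 ≤ (P ^ 2 + Q ^ 2 - 2) * (N - 1) := mul_nonneg (by linarith) (by linarith)
          linarith
        rcases le_or_gt (Q * t) (P * s) with h2 | h2
        · refine le_trans ?_ (le_abs_self _)
          rw [e1]
          have h3 : 0 ≤ (P * t) * (P * s - Q * t) := mul_nonneg (by positivity) (by linarith)
          have h4 : 0 ≤ (P ^ 2 + Q ^ 2) * (N - 1) := mul_nonneg (by positivity) (by linarith)
          linarith
        -- Coordinates in the cone spanned by (Q, P) and (3Q - P, Q), again of determinant 1.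
        obtain ⟨i, hi⟩ : ∃ i, i = Q * s - (3 * Q - P) * t := ⟨_, rfl⟩
        obtain ⟨j, hj⟩ : ∃ j, j = Q * t - P * s := ⟨_, rfl⟩
        have hs' : s = Q * i + (3 * Q - P) * j := by
          rw [hi, hj]; linear_combination -s * hPQ
        have ht' : t = P * i + Q * j := by
          rw [hi, hj]; linear_combination -t * hPQ
        have hi0 : 0 < i := by linarith
        have hj0 : 0 < j := by linarith
        have hlt : i + j < s + t := by
          rw [hs', ht']
          nlinarith [mul_nonneg (by linarith : 0 ≤ 3 * Q - P) hj0.le]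
        refine (ih i j hi0.le hj0.le (by simp [hi0.ne']) (by linarith)).1.trans_eq ?_
        congr 1
        rw [hs', ht']
        linear_combination -(2 * j ^ 2 + (P ^ 2 + Q ^ 2) * (i ^ 2 + 3 * i * j + j ^ 2) -
          6 * P * (P * i + Q * j) * j - 2 * (P * i + Q * j) ^ 2) * hPQ

/-- The form of the family below `1/3`, in coordinates adapted to its minimum `P² + Q² - 2`. -/
theorem le_abs_lowerForm (hQ : 0 < Q) (h7 : 7 * Q ≤ 3 * P) (h3 : P ≤ 3 * Q)
    (hPQ : P ^ 2 - 3 * P * Q + Q ^ 2 = 1) {s t : ℤ} (hst : (s, t) ≠ (0, 0)) :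
    P ^ 2 + Q ^ 2 - 2 ≤
      |(P ^ 2 + Q ^ 2) * s ^ 2 - 3 * (P ^ 2 - Q ^ 2) * s * t - (P ^ 2 + Q ^ 2 - 2) * t ^ 2| := by
  have habs : (|s|, |t|) ≠ (0, 0) := by simpa using hst
  have key := le_abs_lowerForm_aux hQ h7 h3 hPQ (|s| + |t|).toNat |s| |t| (abs_nonneg s)
    (abs_nonneg t) habs (Int.self_le_toNat _)
  rcases le_total 0 s with hs | hs <;> rcases le_total 0 t with ht | ht
  · rw [abs_of_nonneg hs, abs_of_nonneg ht] at key
    exact key.1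
  · rw [abs_of_nonneg hs, abs_of_nonpos ht] at key
    convert key.2 using 2
    ring
  · rw [abs_of_nonpos hs, abs_of_nonneg ht] at key
    convert key.2 using 2
    ring
  · rw [abs_of_nonpos hs, abs_of_nonpos ht] at key
    convert key.1 using 2
    ring

end Lower

/-! ### Markoff data and constants of the two families -/

theorem markoffFormConstant_mem_spectrum {u m m₁ m₂ K l : ℤ} (h : IsMarkoffData u m m₁ m₂ K l) :
    markoffFormConstant m K l ∈ quadraticMarkoffSpectrum := by
  refine ⟨m, 3 * m - 2 * K, -(3 * K - l), ?_, ?_⟩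
  · have h1 : 1 ≤ m := h.pos
    have : (3 * m - 2 * K) ^ 2 - 4 * m * -(3 * K - l) = 9 * m ^ 2 - 4 := by
      linear_combination -4 * h.det
    rw [this]
    nlinarith
  · rw [markoffFormConstant]
    push_cast
    rfl

theorem isMarkoffData_classical {p q : ℤ} (hp : 0 < p) (hq : 0 < q)
    (hpq : p ^ 2 + q ^ 2 - 3 * p * q = -1) : IsMarkoffData 0 p 1 q q (3 * q - p) where
  pos := hp
  pos₁ := one_pos
  pos₂ := hq
  equation := by
    unfold MarkoffEquation
    linear_combination hpq
  congruence := by rw [mul_one]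
  det := by linear_combination -hpq

theorem markoffFormConstant_classical {p q : ℤ} (hp : 0 < p) (hq0 : 0 ≤ q) (hq : 2 * q ≤ 3 * p)
    (hpq : p ^ 2 + q ^ 2 - 3 * p * q = -1) :
    markoffFormConstant p q (3 * q - p) = (p : ℝ) / √(9 * (p : ℝ) ^ 2 - 4) := by
  have hpq' : (p : ℝ) ^ 2 + q ^ 2 - 3 * p * q = -1 := by exact_mod_cast hpq
  rw [markoffFormConstant, markoffConstant_eq_of_isLeast (μ := p)]
  · congr 2
    push_cast
    linear_combination 4 * hpq'
  · intro x y hxy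
    have := le_abs_classicalForm hp hq0 hq hpq hxy
    have h' : (p : ℝ) ≤ |(p : ℝ) * x ^ 2 + (3 * p - 2 * q) * x * y - p * y ^ 2| := by
      exact_mod_cast this
    convert h' using 2
    push_cast
    ring
  · have : (0 : ℝ) ≤ p := by exact_mod_cast hp.le
    exact ⟨1, 0, by simp, by simp [abs_of_nonneg this]⟩

theorem isMarkoffData_lower {P Q : ℤ} (hP : 0 < P) (hQ : 0 < Q)
    (hPQ : P ^ 2 - 3 * P * Q + Q ^ 2 = 1) :
    IsMarkoffData (-2) (P ^ 2 + Q ^ 2) P Q (-3 * Q ^ 2) (Q ^ 2 + (3 * Q - P) ^ 2) where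
  pos := by positivity
  pos₁ := hP
  pos₂ := hQ
  equation := by
    unfold MarkoffEquation
    linear_combination (P ^ 2 + Q ^ 2) * hPQ
  congruence := by
    rw [Int.modEq_iff_dvd]
    exact ⟨Q, by linear_combination -Q * hPQ⟩
  -- Brahmagupta's identity: (P² + Q²)(Q² + (3Q - P)²) is the sum of the squares of P(3Q - P) - Q² =
  -- -1 and PQ + Q(3Q - P) = 3Q².
  det := by linear_combination (P ^ 2 - 3 * P * Q + Q ^ 2 + 1) * hPQ

theorem markoffFormConstant_lower {P Q : ℤ} (hQ : 0 < Q) (h7 : 7 * Q ≤ 3 * P) (h3 : P ≤ 3 * Q)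
    (hPQ : P ^ 2 - 3 * P * Q + Q ^ 2 = 1) :
    markoffFormConstant (P ^ 2 + Q ^ 2) (-3 * Q ^ 2) (Q ^ 2 + (3 * Q - P) ^ 2) =
      (3 * (P : ℝ) * Q - 1) / √(9 * ((P : ℝ) ^ 2 + (Q : ℝ) ^ 2) ^ 2 - 4) := by
  have hPQ' : (P : ℝ) ^ 2 - 3 * P * Q + Q ^ 2 = 1 := by exact_mod_cast hPQ
  -- The substitution s = Px + Qy, t = Qx + (3Q - P)y has determinant -1 and brings the Markoff form
  -- to the shape of `le_abs_lowerForm`.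
  have hform : ∀ x y : ℤ, ((P ^ 2 + Q ^ 2 : ℤ) : ℝ) * x ^ 2 +
      (3 * ((P ^ 2 + Q ^ 2 : ℤ) : ℝ) - 2 * ((-3 * Q ^ 2 : ℤ) : ℝ)) * x * y +
      -(3 * ((-3 * Q ^ 2 : ℤ) : ℝ) - ((Q ^ 2 + (3 * Q - P) ^ 2 : ℤ) : ℝ)) * y ^ 2 =
      (((P ^ 2 + Q ^ 2) * (P * x + Q * y) ^ 2 -
        3 * (P ^ 2 - Q ^ 2) * (P * x + Q * y) * (Q * x + (3 * Q - P) * y) -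
        (P ^ 2 + Q ^ 2 - 2) * (Q * x + (3 * Q - P) * y) ^ 2 : ℤ) : ℝ) := by
    intro x y
    push_cast
    linear_combination -(((P : ℝ) ^ 2 + Q ^ 2) * (x ^ 2 + 3 * x * y + y ^ 2) +
      6 * Q * (Q * x + (3 * Q - P) * y) * y - 2 * (Q * x + (3 * Q - P) * y) ^ 2) * hPQ'
  rw [markoffFormConstant, markoffConstant_eq_of_isLeast (μ := ((P ^ 2 + Q ^ 2 - 2 : ℤ) : ℝ))]
  · congr 2
    · push_cast
      linear_combination hPQ'
    · push_cast
      linear_combination (-4) * ((P : ℝ) ^ 2 - 3 * P * Q + Q ^ 2 + 1) * hPQ'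
  · intro x y hxy
    rw [hform]
    have := le_abs_lowerForm hQ h7 h3 hPQ (s := P * x + Q * y) (t := Q * x + (3 * Q - P) * y) (by
      intro h
      simp only [Prod.mk.injEq] at h
      refine hxy (Prod.ext ?_ ?_)
      · show x = 0
        linear_combination (P - 3 * Q) * h.1 + Q * h.2 - x * hPQ
      · show y = 0
        linear_combination Q * h.1 - P * h.2 - y * hPQ)
    exact_mod_cast this
  -- The vector with (s, t) = (0, 1), where the value is -(P² + Q² - 2).
  · refine ⟨Q, -P, by simp [hQ.ne'], ?_⟩
    have hm : 0 ≤ P ^ 2 + Q ^ 2 - 2 := by nlinarith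
    rw [hform]
    norm_cast
    rw [show (P ^ 2 + Q ^ 2) * (P * Q + Q * -P) ^ 2 -
        3 * (P ^ 2 - Q ^ 2) * (P * Q + Q * -P) * (Q * Q + (3 * Q - P) * -P) -
        (P ^ 2 + Q ^ 2 - 2) * (Q * Q + (3 * Q - P) * -P) ^ 2 = -(P ^ 2 + Q ^ 2 - 2) by
      linear_combination (-(P ^ 2 + Q ^ 2 - 2)) * (P ^ 2 - 3 * P * Q + Q ^ 2 + 1) * hPQ,
      abs_neg, abs_of_nonneg hm]

/-! ### Fibonacci identities and limits -/

theorem fib_add_four_int (n : ℕ) :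
    (Nat.fib (n + 4) : ℤ) = 3 * Nat.fib (n + 2) - Nat.fib n := by
  have h2 : Nat.fib (n + 2) = Nat.fib n + Nat.fib (n + 1) := Nat.fib_add_two
  have h3 : Nat.fib (n + 3) = Nat.fib (n + 1) + Nat.fib (n + 2) := Nat.fib_add_two
  have h4 : Nat.fib (n + 4) = Nat.fib (n + 2) + Nat.fib (n + 3) := Nat.fib_add_two
  omega

theorem fib_odd_norm (n : ℕ) :
    (Nat.fib (2 * n + 3) : ℤ) ^ 2 + (Nat.fib (2 * n + 1) : ℤ) ^ 2 -
      3 * Nat.fib (2 * n + 3) * Nat.fib (2 * n + 1) = -1 := by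
  induction n with
  | zero => norm_num [Nat.fib_add_two]
  | succ n ih =>
    rw [show 2 * (n + 1) + 3 = 2 * n + 1 + 4 by ring, fib_add_four_int,
      show 2 * (n + 1) + 1 = 2 * n + 1 + 2 by ring]
    linear_combination ih

theorem fib_even_norm (n : ℕ) :
    (Nat.fib (2 * n + 2) : ℤ) ^ 2 - 3 * Nat.fib (2 * n + 2) * Nat.fib (2 * n) +
      (Nat.fib (2 * n) : ℤ) ^ 2 = 1 := by
  induction n with
  | zero => norm_num
  | succ n ih =>
    rw [show 2 * (n + 1) + 2 = 2 * n + 4 by ring, fib_add_four_int,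
      show 2 * (n + 1) = 2 * n + 2 by ring]
    linear_combination ih

theorem fib_even_bounds {k : ℕ} (hk : 1 ≤ k) :
    7 * (Nat.fib (2 * k) : ℤ) ≤ 3 * Nat.fib (2 * k + 2) ∧
      (Nat.fib (2 * k + 2) : ℤ) ≤ 3 * Nat.fib (2 * k) := by
  induction k, hk using Nat.le_induction with
  | base => norm_num [Nat.fib_add_two]
  | succ n hn ih =>
    rw [show 2 * (n + 1) + 2 = 2 * n + 4 by ring, fib_add_four_int,
      show 2 * (n + 1) = 2 * n + 2 by ring]
    constructor <;> linarith

theorem tendsto_sub_div_sqrt (c : ℝ) :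
    Tendsto (fun x : ℝ => (x - c) / √(9 * x ^ 2 - 4)) atTop (𝓝 (1 / 3)) := by
  have h1 : Tendsto (fun x : ℝ => (1 - c * x⁻¹) / √(9 - 4 * x⁻¹ ^ 2)) atTop
      (𝓝 ((1 - c * 0) / √(9 - 4 * 0 ^ 2))) := by
    have hinv := tendsto_inv_atTop_zero (𝕜 := ℝ)
    refine Tendsto.div (tendsto_const_nhds.sub (hinv.const_mul c))
      (tendsto_const_nhds.sub ((hinv.pow 2).const_mul 4)).sqrt ?_
    norm_num
  have e : (1 - c * 0) / √(9 - 4 * 0 ^ 2) = 1 / 3 := by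
    rw [show (9 - 4 * 0 ^ 2 : ℝ) = 3 ^ 2 by norm_num, Real.sqrt_sq (by norm_num)]
    norm_num
  rw [e] at h1
  refine h1.congr' ?_
  filter_upwards [eventually_gt_atTop 0] with x hx
  rw [show 9 * x ^ 2 - 4 = x ^ 2 * (9 - 4 * x⁻¹ ^ 2) by field_simp, Real.sqrt_mul (by positivity),
    Real.sqrt_sq hx.le, show x - c = x * (1 - c * x⁻¹) by field_simp]
  exact (mul_div_mul_left _ _ hx.ne').symm

theorem accPt_of_tendsto {u : ℕ → ℝ} {x : ℝ} {S : Set ℝ} (hu : Tendsto u atTop (𝓝 x))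
    (hS : ∀ᶠ n in atTop, u n ≠ x ∧ u n ∈ S) : AccPt x (𝓟 S) :=
  accPt_iff_frequently.2 (hu.frequently hS.frequently)

theorem tendsto_lowerConstant :
    Tendsto (fun k : ℕ => lowerConstant (Nat.fib (2 * k + 2)) (Nat.fib (2 * k))) atTop
      (𝓝 (1 / 3)) := by
  have hm : Tendsto (fun k : ℕ => (Nat.fib (2 * k + 2) : ℝ) ^ 2 + (Nat.fib (2 * k) : ℝ) ^ 2) atTop
      atTop := by
    refine tendsto_atTop_mono (fun k => ?_) tendsto_natCast_atTop_atTop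
    have h : 2 * k + 2 ≤ Nat.fib (2 * k + 2) + 1 := Nat.le_fib_add_one _
    have h' : (k : ℝ) + 1 ≤ Nat.fib (2 * k + 2) := by exact_mod_cast (by omega)
    nlinarith [sq_nonneg (Nat.fib (2 * k) : ℝ), (Nat.cast_nonneg k : (0 : ℝ) ≤ k)]
  -- With m = P² + Q² the norm relation turns the numerator 3PQ - 1 into m - 2.
  refine ((tendsto_sub_div_sqrt 2).comp hm).congr fun k => ?_
  have hn : (Nat.fib (2 * k + 2) : ℝ) ^ 2 - 3 * Nat.fib (2 * k + 2) * Nat.fib (2 * k) +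
      (Nat.fib (2 * k) : ℝ) ^ 2 = 1 := by exact_mod_cast fib_even_norm k
  simp only [Function.comp_apply, lowerConstant]
  congr 1
  linear_combination hn

theorem lowerConstant_lt {P Q : ℕ} (hPQ : (P : ℤ) ^ 2 - 3 * P * Q + (Q : ℤ) ^ 2 = 1)
    (hP : 0 < P) (hQ : 0 < Q) : lowerConstant P Q < 1 / 3 := by
  have hn : (P : ℝ) ^ 2 - 3 * P * Q + (Q : ℝ) ^ 2 = 1 := by exact_mod_cast hPQ
  have hQ1 : (1 : ℝ) ≤ Q := by exact_mod_cast hQ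
  have hP1 : (1 : ℝ) ≤ P := by exact_mod_cast hP
  set m : ℝ := (P : ℝ) ^ 2 + (Q : ℝ) ^ 2 with hm
  have hm1 : 2 ≤ m := by nlinarith
  have hpos : 0 < √(9 * m ^ 2 - 4) := Real.sqrt_pos.2 (by nlinarith)
  rw [lowerConstant, div_lt_iff₀ hpos, show 3 * (P : ℝ) * Q - 1 = m - 2 by linarith]
  have h : 3 * (m - 2) < √(9 * m ^ 2 - 4) := by
    apply Real.lt_sqrt_of_sq_lt
    nlinarith
  linarith

theorem one_third_lt_div_sqrt {m : ℝ} (hm : 1 ≤ m) : 1 / 3 < m / √(9 * m ^ 2 - 4) := by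
  have hpos : 0 < √(9 * m ^ 2 - 4) := Real.sqrt_pos.2 (by nlinarith)
  rw [lt_div_iff₀ hpos]
  have h : √(9 * m ^ 2 - 4) < 3 * m := by
    rw [Real.sqrt_lt' (by linarith)]
    linarith
  linarith

/-- The Markoff constants of the Fibonacci branch of the Markoff tree accumulate at `1/3`. -/
theorem accPt_classical : AccPt (1 / 3 : ℝ) (𝓟 {C : ℝ | C ∈ quadraticMarkoffSpectrum ∧ 1 / 3 < C ∧
    ∃ m m₁ m₂ K l : ℤ, IsMarkoffData 0 m m₁ m₂ K l ∧
      C = markoffFormConstant m K l ∧ C = (m : ℝ) / √(9 * (m : ℝ) ^ 2 - 4)}) := by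
  have hm : Tendsto (fun n : ℕ => ((Nat.fib (2 * n + 3) : ℤ) : ℝ)) atTop atTop := by
    refine tendsto_atTop_mono (fun n => ?_) tendsto_natCast_atTop_atTop
    have h : 2 * n + 3 ≤ Nat.fib (2 * n + 3) + 1 := Nat.le_fib_add_one _
    exact_mod_cast (by omega : n ≤ Nat.fib (2 * n + 3))
  refine accPt_of_tendsto ((tendsto_sub_div_sqrt 0).comp hm) (Eventually.of_forall fun n => ?_)
  have hp : (0 : ℤ) < Nat.fib (2 * n + 3) := by exact_mod_cast Nat.fib_pos.2 (by omega)
  have hq : (0 : ℤ) < Nat.fib (2 * n + 1) := by exact_mod_cast Nat.fib_pos.2 (by omega)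
  have hle : (Nat.fib (2 * n + 1) : ℤ) ≤ Nat.fib (2 * n + 3) := by
    exact_mod_cast Nat.fib_mono (by omega)
  have hpq := fib_odd_norm n
  simp only [Function.comp_apply, sub_zero]
  generalize (Nat.fib (2 * n + 3) : ℤ) = p at *
  generalize (Nat.fib (2 * n + 1) : ℤ) = q at *
  have hlt : 1 / 3 < (p : ℝ) / √(9 * (p : ℝ) ^ 2 - 4) :=
    one_third_lt_div_sqrt (by exact_mod_cast hp)
  have hdata := isMarkoffData_classical hp hq hpq
  have hconst := markoffFormConstant_classical hp hq.le (by linarith) hpq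
  exact ⟨hlt.ne', hconst ▸ markoffFormConstant_mem_spectrum hdata, hlt, p, 1, q, q, 3 * q - p,
    hdata, hconst.symm, rfl⟩

theorem lowerConstant_fib_spec {k : ℕ} (hk : 1 ≤ k) :
    lowerConstant (Nat.fib (2 * k + 2)) (Nat.fib (2 * k)) ∈ quadraticMarkoffSpectrum ∧
      lowerConstant (Nat.fib (2 * k + 2)) (Nat.fib (2 * k)) < 1 / 3 ∧
      ∃ K l : ℤ,
        IsMarkoffData (-2) ((Nat.fib (2 * k + 2) : ℤ) ^ 2 + (Nat.fib (2 * k) : ℤ) ^ 2)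
          (Nat.fib (2 * k + 2)) (Nat.fib (2 * k)) K l ∧
        lowerConstant (Nat.fib (2 * k + 2)) (Nat.fib (2 * k)) =
          markoffFormConstant ((Nat.fib (2 * k + 2) : ℤ) ^ 2 + (Nat.fib (2 * k) : ℤ) ^ 2) K l := by
  have hP : 0 < Nat.fib (2 * k + 2) := Nat.fib_pos.2 (by omega)
  have hQ : 0 < Nat.fib (2 * k) := Nat.fib_pos.2 (by omega)
  have hn := fib_even_norm k
  obtain ⟨h7, h3⟩ := fib_even_bounds hk
  have hdata := isMarkoffData_lower (by exact_mod_cast hP) (by exact_mod_cast hQ) hn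
  have hconst := markoffFormConstant_lower (by exact_mod_cast hQ) h7 h3 hn
  rw [Int.cast_natCast, Int.cast_natCast] at hconst
  change _ = lowerConstant _ _ at hconst
  exact ⟨hconst ▸ markoffFormConstant_mem_spectrum hdata, lowerConstant_lt hn hP hQ, _, _, hdata,
    hconst.symm⟩

theorem mainTheorem8 :
    -- `1/3` is the largest accumulation point of the quadratic Markoff spectrum
    IsGreatest {x : ℝ | AccPt x (𝓟 quadraticMarkoffSpectrum)} (1 / 3) ∧
    -- it is approached from above, and from below
    AccPt (1 / 3 : ℝ) (𝓟 (quadraticMarkoffSpectrum ∩ Set.Ioi (1 / 3))) ∧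
    AccPt (1 / 3 : ℝ) (𝓟 (quadraticMarkoffSpectrum ∩ Set.Iio (1 / 3))) ∧
    -- from above, by classical Markoff constants
    AccPt (1 / 3 : ℝ) (𝓟 {C : ℝ | C ∈ quadraticMarkoffSpectrum ∧ 1 / 3 < C ∧
      ∃ m m₁ m₂ K l : ℤ, IsMarkoffData 0 m m₁ m₂ K l ∧
        C = markoffFormConstant m K l ∧ C = (m : ℝ) / √(9 * (m : ℝ) ^ 2 - 4)}) ∧
    -- from below, by the constants of a Fibonacci family of solutions of `M⁺⁺(2,0,u)`, `u = -2`
    (∀ k : ℕ, 1 ≤ k →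
      lowerConstant (Nat.fib (2 * k + 2)) (Nat.fib (2 * k)) ∈ quadraticMarkoffSpectrum ∧
      lowerConstant (Nat.fib (2 * k + 2)) (Nat.fib (2 * k)) < 1 / 3 ∧
      ∃ K l : ℤ,
        IsMarkoffData (-2) ((Nat.fib (2 * k + 2) : ℤ) ^ 2 + (Nat.fib (2 * k) : ℤ) ^ 2)
          (Nat.fib (2 * k + 2)) (Nat.fib (2 * k)) K l ∧
        lowerConstant (Nat.fib (2 * k + 2)) (Nat.fib (2 * k)) =
          markoffFormConstant ((Nat.fib (2 * k + 2) : ℤ) ^ 2 + (Nat.fib (2 * k) : ℤ) ^ 2) K l) ∧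
    Tendsto (fun k : ℕ => lowerConstant (Nat.fib (2 * k + 2)) (Nat.fib (2 * k))) atTop
      (𝓝 (1 / 3)) := by
  have habove : AccPt (1 / 3 : ℝ) (𝓟 (quadraticMarkoffSpectrum ∩ Set.Ioi (1 / 3))) :=
    accPt_classical.mono (principal_mono.2 fun C hC => ⟨hC.1, hC.2.1⟩)
  refine ⟨⟨habove.mono (principal_mono.2 Set.inter_subset_left),
    fun x hx => le_of_accPt_quadraticMarkoffSpectrum hx⟩, habove, ?_, accPt_classical,
    fun k hk => lowerConstant_fib_spec hk, tendsto_lowerConstant⟩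
  refine accPt_of_tendsto tendsto_lowerConstant ?_
  filter_upwards [eventually_ge_atTop 1] with k hk
  obtain ⟨h1, h2, -⟩ := lowerConstant_fib_spec hk
  exact ⟨h2.ne, h1, h2⟩
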